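/- Fix $n\ge 4$ and put $v=n(n-3)/2$. For all dimensions $p,q$ let $(X_1,Y_1),\dots,(X_n,Y_n)$ be i.i.d. copies of a random vector $(X,Y)$ in $\mathbb R^p\times\mathbb R^q$ (whose law may depend on $(p,q)$), $X_s=(x_{s1},\dots,x_{sp})$, $Y_s=(y_{s1},\dots,y_{sq})$, and write $\mathbf X=(X_1,\dots,X_n)^T$, $\mathbf Y=(Y_1,\dots,Y_n)^T$. Let $k,l:\mathbb R\times\mathbb R\to\mathbb R$ be measurable symmetric kernels. For $s\neq t$ put $$k_{st}(i)=k(x_{si},x_{ti})-E[k(x_{si},x_{ti})\mid x_{si}]-E[k(x_{si},x_{ti})\mid x_{ti}]+E[k(x_{si},x_{ti})],$$ define $l_{st}(j)$ in the same way from $l$ and the $y_{sj}$, and put $k_{ss}(i)=l_{ss}(j)=0$; here $k(x_{si},x_{ti})$ and $l(y_{sj},y_{tj})$, $s\ne t$, are assumed integrable, and $k_{st}(i)$, $l_{st}(j)$ square integrable. For an $n\times n$ matrix $\mathbf A=(a_{st})$ its $\mathcal U$-centered version $\widetilde{\mathbf A}=(\tilde a_{st})$ has zero diagonal and, for $s\ne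 t$, $$\tilde a_{st}=a_{st}-\tfrac1{n-2}\sum_{w} a_{sw}-\tfrac1{n-2}\sum_{u} a_{ut}+\tfrac1{(n-1)(n-2)}\sum_{u,w}a_{uw},$$ and $(\widetilde{\mathbf A}\cdot\widetilde{\mathbf B})=\frac1{n(n-3)}\sum_{s\ne t}\tilde a_{st}\tilde b_{st}$. With $\mathbf K(i)=(k_{st}(i))_{s,t}$ and $\mathbf L(j)=(l_{st}(j))_{s,t}$ let $$uCov_n^2(\mathbf X,\mathbf Y)=\frac1{\sqrt{pq}}\sum_{i=1}^p\sum_{j=1}^q(\widetilde{\mathbf K}(i)\cdot\widetilde{\mathbf L}(j)),$$ and define $uCov_n^2(\mathbf X,\mathbf X)$ (using $k$ twice) and $uCov_n^2(\mathbf Y,\mathbf Y)$ (using $l$ twice) in the same way. Assume: (D1) there are constants $0<a\le b<\infty$ and $0<a'\le b'<\infty$ such that, for all $p,q$, $a\le \mathrm{var}(x_i)\le E(x_i^2)\le b$ for every coordinate of $X$ and $a'\le \mathrm{var}(y_j)\le E(y_j^2)\le b'$ for every coordinate of $Y$; (D3) as $p\wedge q\to\infty$, $$\Big(p^{-1/2}\sum_{i=1}^p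 k_{st}(i),\; q^{-1/2}\sum_{j=1}^q l_{uw}(j)\Big)_{s<t,\;u<w}\overset{d}{\to}(c_{st},d_{uw})_{s<t,\;u<w},$$ where $\{c_{st},d_{uw}\}$ is jointly Gaussian, and there are constants $\sigma_x^2,\sigma_y^2,\sigma_{xy}^2$ such that for all $s<t$ $$\mathrm{var}[c_{st}]=\sigma_x^2=\lim\frac1p\sum_{i,j=1}^p\mathrm{cov}[k_{st}(i),k_{st}(j)],\qquad \mathrm{var}[d_{st}]=\sigma_y^2=\lim\frac1q\sum_{i,j=1}^q\mathrm{cov}[l_{st}(i),l_{st}(j)],$$ $$\mathrm{cov}[c_{st},d_{st}]=\sigma_{xy}^2=\lim\frac1{\sqrt{pq}}\sum_{i=1}^p\sum_{j=1}^q\mathrm{cov}[k_{st}(i),l_{st}(j)],$$ all limits being taken as $p\wedge q\to\infty$ (nothing is assumed about the other covariances, and $\sigma_{xy}^2$ may be negative). Let $\mathbf c=(c_{st})_{s<t}$, $\mathbf d=(d_{st})_{s<t}$, and let $\mathbf M$ be the $\frac{n(n-1)}2\times\frac{n(n-1)}2$ matrix of the linear map that sends the upper triangular part $(c_{st})_{s<t}$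 of a symmetric matrix $\mathbf C$ with zero diagonal to the upper triangular part of $\widetilde{\mathbf C}$. Then $\mathbf M$, which depends only on $n$, is a projection matrix ($\mathbf M^T=\mathbf M=\mathbf M^2$) of rank $v$, $$\begin{pmatrix}\mathbf c\\ \mathbf d\end{pmatrix}\sim N\left(\mathbf 0,\begin{pmatrix}\sigma_x^2\mathbf I_{n(n-1)/2}&\sigma_{xy}^2\mathbf I_{n(n-1)/2}\\ \sigma_{xy}^2\mathbf I_{n(n-1)/2}&\sigma_y^2\mathbf I_{n(n-1)/2}\end{pmatrix}\right),$$ and, as $p\wedge q\to\infty$, $$uCov_n^2(\mathbf X,\mathbf Y)\overset{d}{\to}\tfrac1v\,\mathbf c^T\mathbf M\mathbf d,$$ $$uCov_n^2(\mathbf X,\mathbf X)\overset{d}{\to}\tfrac1v\,\mathbf c^T\mathbf M\mathbf c\overset{d}{=}\tfrac{\sigma_x^2}{v}\chi^2_v,\qquad uCov_n^2(\mathbf Y,\mathbf Y)\overset{d}{\to}\tfrac1v\,\mathbf d^T\mathbf M\mathbf d\overset{d}{=}\tfrac{\sigma_y^2}{v}\chi^2_v.$$ -/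

import Mathlib

open MeasureTheory ProbabilityTheory Filter Topology
open scoped Matrix

noncomputable section

/-- The `𝒰`-centered version of a square matrix. -/
def uCenter {n : ℕ} (A : Matrix (Fin n) (Fin n) ℝ) : Matrix (Fin n) (Fin n) ℝ :=
  Matrix.of fun s t =>
    if s = t then 0
    else A s t - 1 / ((n : ℝ) - 2) * ∑ v, A s v - 1 / ((n : ℝ) - 2) * ∑ u, A u t
      + 1 / (((n : ℝ) - 1) * ((n : ℝ) - 2)) * ∑ u, ∑ v, A u v

/-- The inner product `(A · B) = (n(n-3))⁻¹ ∑_{s ≠ t} a_{st} b_{st}` of `𝒰`-centered matrices. -/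
def uInner {n : ℕ} (A B : Matrix (Fin n) (Fin n) ℝ) : ℝ :=
  1 / ((n : ℝ) * ((n : ℝ) - 3)) * ∑ s, ∑ t, if s = t then 0 else A s t * B s t

/-- The random matrix `(k_{st})` of double centered kernel distances of a scalar sample
`x_1, …, x_n`. For `s ≠ t`,
`k_{st} = k(x_s,x_t) - E[k(x_s,x_t) | x_s] - E[k(x_s,x_t) | x_t] + E[k(x_s,x_t)]`;
the diagonal is zero (for a kernel that is constant on the diagonal, the formula
itself gives `k_{ss} = 0`). -/
def doubleCentered {Ω : Type*} [MeasurableSpace Ω] {n : ℕ} (μ : Measure Ω) (k : ℝ → ℝ → ℝ)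
    (x : Fin n → Ω → ℝ) (ω : Ω) : Matrix (Fin n) (Fin n) ℝ :=
  Matrix.of fun s t =>
    if s = t then 0
    else k (x s ω) (x t ω)
      - (μ[fun ω' => k (x s ω') (x t ω') | MeasurableSpace.comap (x s) inferInstance]) ω
      - (μ[fun ω' => k (x s ω') (x t ω') | MeasurableSpace.comap (x t) inferInstance]) ω
      + ∫ ω', k (x s ω') (x t ω') ∂μ

/-- The unified statistic `uCov_n²(𝐗, 𝐘)` with kernels `k` and `l`; `X s i` is the `i`-th
coordinate of the `s`-th observation. -/
def uCov {Ω : Type*} [MeasurableSpace Ω] {n p q : ℕ} (μ : Measure Ω) (k l : ℝ → ℝ → ℝ)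
    (X : Fin n → Fin p → Ω → ℝ) (Y : Fin n → Fin q → Ω → ℝ) (ω : Ω) : ℝ :=
  1 / Real.sqrt ((p : ℝ) * (q : ℝ)) * ∑ i : Fin p, ∑ j : Fin q,
    uInner (uCenter (doubleCentered μ k (fun s => X s i) ω))
      (uCenter (doubleCentered μ l (fun s => Y s j) ω))

/-- The index set of pairs `s < t` in `{1, …, n}`; it has `n(n-1)/2` elements. -/
abbrev IdxPair (n : ℕ) : Type := {a : Fin n × Fin n // a.1 < a.2}

/-- The matrix `𝐌`: it sends the upper triangular part `(c_{st})_{s<t}` of a symmetric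
matrix `C` with zero diagonal to the upper triangular part of the `𝒰`-centered version of `C`.
Its column `b = (u, v)` is that image for the matrix with entries one
at `(u, v)` and `(v, u)`. -/
def projMatrix (n : ℕ) : Matrix (IdxPair n) (IdxPair n) ℝ :=
  Matrix.of fun a b =>
    uCenter (Matrix.single b.1.1 b.1.2 (1 : ℝ) + Matrix.single b.1.2 b.1.1 (1 : ℝ)) a.1.1 a.1.2

/-- The chi-square distribution with `v` degrees of freedom. -/
def chiSquare (v : ℕ) : Measure ℝ :=
  (Measure.pi fun _ : Fin v => gaussianReal 0 1).map fun z => ∑ i, z i ^ 2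

/-- `(X_1, Y_1), …, (X_n, Y_n)` are i.i.d. random vectors with law `P` on `ℝ^p × ℝ^q`. -/
structure IsIIDSample {Ω : Type*} [MeasurableSpace Ω] {n p q : ℕ} (μ : Measure Ω)
    (P : Measure ((Fin p → ℝ) × (Fin q → ℝ)))
    (X : Fin n → Fin p → Ω → ℝ) (Y : Fin n → Fin q → Ω → ℝ) : Prop where
  measurable_X : ∀ s i, Measurable (X s i)
  measurable_Y : ∀ s j, Measurable (Y s j)
  indep : iIndepFun
    (fun (s : Fin n) (ω : Ω) => ((fun i => X s i ω : Fin p → ℝ), (fun j => Y s j ω : Fin q → ℝ))) μ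
  law : ∀ s, HasLaw (fun ω => ((fun i => X s i ω : Fin p → ℝ), (fun j => Y s j ω : Fin q → ℝ))) P μ

/-- Uniform moment bounds: the coordinates of `X` and `Y` have variances bounded below and second
moments bounded above, uniformly over all coordinates and all dimensions `(p, q)`. -/
def UniformMomentBounds
    (P : (r : ℕ × ℕ) → Measure ((Fin r.1 → ℝ) × (Fin r.2 → ℝ))) : Prop :=
  ∃ a b a' b' : ℝ, 0 < a ∧ 0 < a' ∧ ∀ r : ℕ × ℕ,
    (∀ i : Fin r.1, MemLp (fun z => z.1 i) 2 (P r) ∧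
      a ≤ Var[fun z => z.1 i; P r] ∧ ∫ z, z.1 i ^ 2 ∂(P r) ≤ b) ∧
    (∀ j : Fin r.2, MemLp (fun z => z.2 j) 2 (P r) ∧
      a' ≤ Var[fun z => z.2 j; P r] ∧ ∫ z, z.2 j ^ 2 ∂(P r) ≤ b')

/-- A (measurable, symmetric) bivariate kernel on the real line. -/
structure IsKernel (k : ℝ → ℝ → ℝ) : Prop where
  measurable : Measurable (Function.uncurry k)
  symm : ∀ x y, k x y = k y x

/-- The moments in the definition of `k_{st}(i)` and of the covariances of the `k_{st}(i)` exist: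
each `k(x_{si}, x_{ti})`, `s ≠ t`, is integrable and each `k_{st}(i)` is square integrable. -/
def KernelMoments {Ω : Type*} [MeasurableSpace Ω] {n p : ℕ} (μ : Measure Ω) (k : ℝ → ℝ → ℝ)
    (X : Fin n → Fin p → Ω → ℝ) : Prop :=
  ∀ (i : Fin p) (s t : Fin n), s ≠ t →
    Integrable (fun ω => k (X s i ω) (X t i ω)) μ ∧
    MemLp (fun ω => doubleCentered μ k (fun s => X s i) ω s t) 2 μ

/-- The vector `(p^{-1/2} ∑_i k_{st}(i))_{s<t}`. -/
def scaledSum {Ω : Type*} [MeasurableSpace Ω] {n p : ℕ} (μ : Measure Ω) (k : ℝ → ℝ → ℝ)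
    (X : Fin n → Fin p → Ω → ℝ) (ω : Ω) : IdxPair n → ℝ :=
  fun a => 1 / Real.sqrt (p : ℝ) *
    ∑ i : Fin p, doubleCentered μ k (fun s => X s i) ω a.1.1 a.1.2

/-- The joint Gaussian central limit assumption with limit `(c, d)` and constants
`σx2 = σ_x²`, `σy2 = σ_y²`, `σxy2 = σ_xy²`. The filter `atTop` on `ℕ × ℕ` is `p ∧ q → ∞`. -/
structure JointGaussianCLT {n : ℕ} {Ω : ℕ × ℕ → Type*} [∀ r, MeasurableSpace (Ω r)]
    (μ : (r : ℕ × ℕ) → Measure (Ω r)) [∀ r, IsProbabilityMeasure (μ r)] (k l : ℝ → ℝ → ℝ)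
    (X : (r : ℕ × ℕ) → Fin n → Fin r.1 → Ω r → ℝ)
    (Y : (r : ℕ × ℕ) → Fin n → Fin r.2 → Ω r → ℝ)
    {Ω' : Type*} [MeasurableSpace Ω'] (μ' : Measure Ω') [IsProbabilityMeasure μ']
    (c d : Ω' → IdxPair n → ℝ) (σx2 σy2 σxy2 : ℝ) : Prop where
  tendsto : TendstoInDistribution
    (fun r ω => (scaledSum (μ r) k (X r) ω, scaledSum (μ r) l (Y r) ω)) atTop
    (fun ω => (c ω, d ω)) μ μ'
  gaussian : IsGaussian (μ'.map fun ω => (c ω, d ω))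
  var_c : ∀ a, Var[fun ω => c ω a; μ'] = σx2
  var_d : ∀ a, Var[fun ω => d ω a; μ'] = σy2
  cov_cd : ∀ a, cov[fun ω => c ω a, fun ω => d ω a; μ'] = σxy2
  tendsto_x : ∀ a : IdxPair n, Tendsto (fun r : ℕ × ℕ => 1 / (r.1 : ℝ) *
    ∑ i : Fin r.1, ∑ j : Fin r.1,
      cov[fun ω => doubleCentered (μ r) k (fun s => X r s i) ω a.1.1 a.1.2,
        fun ω => doubleCentered (μ r) k (fun s => X r s j) ω a.1.1 a.1.2; μ r]) atTop (𝓝 σx2)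
  tendsto_y : ∀ a : IdxPair n, Tendsto (fun r : ℕ × ℕ => 1 / (r.2 : ℝ) *
    ∑ i : Fin r.2, ∑ j : Fin r.2,
      cov[fun ω => doubleCentered (μ r) l (fun s => Y r s i) ω a.1.1 a.1.2,
        fun ω => doubleCentered (μ r) l (fun s => Y r s j) ω a.1.1 a.1.2; μ r]) atTop (𝓝 σy2)
  tendsto_xy : ∀ a : IdxPair n, Tendsto (fun r : ℕ × ℕ =>
    1 / Real.sqrt ((r.1 : ℝ) * (r.2 : ℝ)) * ∑ i : Fin r.1, ∑ j : Fin r.2,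
      cov[fun ω => doubleCentered (μ r) k (fun s => X r s i) ω a.1.1 a.1.2,
        fun ω => doubleCentered (μ r) l (fun s => Y r s j) ω a.1.1 a.1.2; μ r]) atTop (𝓝 σxy2)

/-- The block matrix with blocks `σ_x² 𝐈`, `σ_xy² 𝐈`, `σ_xy² 𝐈`, `σ_y² 𝐈`. -/
def blockCov (n : ℕ) (σx2 σy2 σxy2 : ℝ) :
    Matrix (IdxPair n ⊕ IdxPair n) (IdxPair n ⊕ IdxPair n) ℝ :=
  Matrix.fromBlocks (σx2 • 1) (σxy2 • 1) (σxy2 • 1) (σy2 • 1)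

end

/-! The statistic is, for every fixed `p, q`, exactly `(1/v) cᵀ M d` evaluated at the scaled sums
(`uCov_eq`): centering is linear, the inner product is bilinear, and the sums over coordinates move
inside. The limits in distribution then follow from the continuous mapping theorem.

Centering annihilates row sums, so it is idempotent on symmetric matrices with zero diagonal. Its
matrix `M` has symmetric entries, so it is an orthogonal projection, and its rank is its trace.

The law of `(c, d)` needs more, since the hypotheses give neither the mean of the limit nor its
covariances at distinct pairs. Convergence in law alone does not carry moments over, but Fatou's
lemma gives an inequality: `E W² ≤ lim E Z_r²`. Since the right side is assumed to be `Var W`, it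
follows that `(E W)² ≤ 0`. Applied to `W_i ± W_j`, the same inequality bounds the covariance from
both sides by zero, provided the prelimit variables are orthogonal
(`centered_and_uncorrelated_of_tendstoInDistribution`). Orthogonality holds because, of two distinct
pairs, the first has an index absent from the second, and `k_st` has conditional mean zero given all
observations but that one (`integral_doubleCentered_mul_of_ne`).

Finally, in an orthonormal basis of the range of `M`, the form `cᵀ M c` is a sum of `v` squares of
independent `N(0, σ_x²)` variables, and likewise for `d` (`hasLaw_chiSquare_quadraticForm`). -/

/-! ### `𝒰`-centering as an idempotent linear map -/

/-- The matrix entries of `uCenter`. -/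
lemma uCenter_apply {n : ℕ} (A : Matrix (Fin n) (Fin n) ℝ) (s t : Fin n) :
    uCenter A s t = if s = t then 0
      else A s t - 1 / ((n : ℝ) - 2) * ∑ v, A s v - 1 / ((n : ℝ) - 2) * ∑ u, A u t
        + 1 / (((n : ℝ) - 1) * ((n : ℝ) - 2)) * ∑ u, ∑ v, A u v := rfl

lemma uCenter_add {n : ℕ} (A B : Matrix (Fin n) (Fin n) ℝ) :
    uCenter (A + B) = uCenter A + uCenter B := by
  ext s t
  simp only [uCenter_apply, Matrix.add_apply, Finset.sum_add_distrib]
  split_ifs <;> ring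

lemma uCenter_smul {n : ℕ} (c : ℝ) (A : Matrix (Fin n) (Fin n) ℝ) :
    uCenter (c • A) = c • uCenter A := by
  ext s t
  simp only [uCenter_apply, Matrix.smul_apply, smul_eq_mul, ← Finset.mul_sum]
  split_ifs <;> ring

/-- `𝒰`-centering as a linear map. -/
noncomputable def uCenterLinear (n : ℕ) :
    Matrix (Fin n) (Fin n) ℝ →ₗ[ℝ] Matrix (Fin n) (Fin n) ℝ where
  toFun := uCenter
  map_add' := uCenter_add
  map_smul' := uCenter_smul

lemma uCenter_sum {n : ℕ} {ι : Type*} (s : Finset ι) (A : ι → Matrix (Fin n) (Fin n) ℝ) :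
    uCenter (∑ i ∈ s, A i) = ∑ i ∈ s, uCenter (A i) :=
  map_sum (uCenterLinear n) A s

lemma uCenter_diag {n : ℕ} (A : Matrix (Fin n) (Fin n) ℝ) (s : Fin n) : uCenter A s s = 0 := by
  simp [uCenter_apply]

lemma uCenter_symm {n : ℕ} {A : Matrix (Fin n) (Fin n) ℝ} (hA : ∀ s t, A s t = A t s)
    (s t : Fin n) : uCenter A s t = uCenter A t s := by
  have h : ∀ s, ∑ u, A u s = ∑ u, A s u := fun s => Finset.sum_congr rfl fun u _ => hA u s
  simp only [uCenter_apply, h, eq_comm (a := s) (b := t), hA s t]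
  split_ifs <;> ring

/-- This is what the constants `n - 2` and `n - 1` are made for: with row sum `R` and total `T`, the
`n - 1` off-diagonal terms add up to `R - (n-1)R/(n-2) - (T-R)/(n-2) + T/(n-2) = 0`. -/
lemma sum_uCenter_row {n : ℕ} (hn : 3 ≤ n) {A : Matrix (Fin n) (Fin n) ℝ}
    (hA : ∀ s t, A s t = A t s) (h0 : ∀ s, A s s = 0) (s : Fin n) : ∑ t, uCenter A s t = 0 := by
  have hn' : (3 : ℝ) ≤ n := by exact_mod_cast hn
  have hcol : ∀ s, ∑ u, A u s = ∑ u, A s u := fun s => Finset.sum_congr rfl fun u _ => hA u s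
  set R : Fin n → ℝ := fun s => ∑ u, A s u with hR
  set T : ℝ := ∑ u, ∑ v, A u v with hT
  have hRT : ∑ t, R t = T := rfl
  -- The off-diagonal formula is used for every `t`, and its spurious value at `t = s` is subtracted
  -- again.
  have key : ∀ t, uCenter A s t = (A s t - 1 / ((n : ℝ) - 2) * R s - 1 / ((n : ℝ) - 2) * R t
      + 1 / (((n : ℝ) - 1) * ((n : ℝ) - 2)) * T)
      - if s = t then (- 2 / ((n : ℝ) - 2) * R s + 1 / (((n : ℝ) - 1) * ((n : ℝ) - 2)) * T)
        else 0 := by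
    intro t
    rw [uCenter_apply]
    split_ifs with h
    · subst h
      rw [h0]
      ring
    · rw [hcol t]
      ring
  simp only [key, Finset.sum_sub_distrib, Finset.sum_add_distrib, ← Finset.mul_sum, hRT,
    Finset.sum_const, Finset.card_univ, Fintype.card_fin, nsmul_eq_mul, Finset.sum_ite_eq,
    Finset.mem_univ, if_true]
  change R s - _ - _ + _ - _ = 0
  have h1 : (n : ℝ) - 1 ≠ 0 := by linarith
  have h2 : (n : ℝ) - 2 ≠ 0 := by linarith
  field_simp
  ring

/-- After one centering all row and column sums vanish, so the second has nothing to subtract. -/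
lemma uCenter_uCenter {n : ℕ} (hn : 3 ≤ n) {A : Matrix (Fin n) (Fin n) ℝ}
    (hA : ∀ s t, A s t = A t s) (h0 : ∀ s, A s s = 0) : uCenter (uCenter A) = uCenter A := by
  have hr := sum_uCenter_row hn hA h0
  have hc : ∀ t, ∑ u, uCenter A u t = 0 := fun t =>
    (Finset.sum_congr rfl fun u _ => uCenter_symm hA u t).trans (hr t)
  ext s t
  rw [uCenter_apply (uCenter A)]
  simp only [hr, hc, Finset.sum_const_zero]
  split_ifs with h
  · rw [h, uCenter_diag]
  · ring

/-! ### The matrix `𝐌` in upper triangular coordinates -/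

/-- The symmetric matrix with zero diagonal and prescribed upper triangular part. -/
def symmOfUpper {n : ℕ} (c : IdxPair n → ℝ) : Matrix (Fin n) (Fin n) ℝ :=
  Matrix.of fun s t => if h : s < t then c ⟨(s, t), h⟩ else if h : t < s then c ⟨(t, s), h⟩ else 0

lemma symmOfUpper_symm {n : ℕ} (c : IdxPair n → ℝ) (s t : Fin n) :
    symmOfUpper c s t = symmOfUpper c t s := by
  simp only [symmOfUpper, Matrix.of_apply]
  split_ifs with h1 h2 <;> first | rfl | exact absurd h1 (lt_asymm h2)

lemma symmOfUpper_diag {n : ℕ} (c : IdxPair n → ℝ) (s : Fin n) : symmOfUpper c s s = 0 := by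
  simp [symmOfUpper]

lemma eq_symmOfUpper {n : ℕ} {A : Matrix (Fin n) (Fin n) ℝ}
    (hA : ∀ s t, A s t = A t s) (h0 : ∀ s, A s s = 0) :
    symmOfUpper (fun a => A a.1.1 a.1.2) = A := by
  ext s t
  simp only [symmOfUpper, Matrix.of_apply]
  split_ifs with h1 h2
  · rfl
  · exact hA t s
  · obtain rfl : s = t := le_antisymm (not_lt.1 h2) (not_lt.1 h1)
    exact (h0 s).symm

lemma symmOfUpper_eq_sum {n : ℕ} (c : IdxPair n → ℝ) :
    symmOfUpper c = ∑ b : IdxPair n, c b •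
      (Matrix.single b.1.1 b.1.2 (1 : ℝ) + Matrix.single b.1.2 b.1.1 (1 : ℝ)) := by
  have key : ∀ b : IdxPair n, symmOfUpper (Pi.single b (1 : ℝ)) =
      Matrix.single b.1.1 b.1.2 (1 : ℝ) + Matrix.single b.1.2 b.1.1 (1 : ℝ) := by
    intro b
    obtain ⟨⟨u, w⟩, huw⟩ := b
    ext s t
    simp only [symmOfUpper, Matrix.of_apply, Matrix.add_apply, Matrix.single_apply, Pi.single_apply,
      Subtype.mk.injEq, Prod.mk.injEq]
    simp only at huw
    grind
  simp only [← key]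
  ext s t
  simp only [Matrix.sum_apply, Matrix.smul_apply, smul_eq_mul]
  simp only [symmOfUpper, Matrix.of_apply]
  split_ifs <;> simp [Pi.single_apply]

lemma projMatrix_mulVec {n : ℕ} (c : IdxPair n → ℝ) (a : IdxPair n) :
    (projMatrix n *ᵥ c) a = uCenter (symmOfUpper c) a.1.1 a.1.2 := by
  rw [symmOfUpper_eq_sum, uCenter_sum]
  simp only [uCenter_smul, Matrix.sum_apply, Matrix.smul_apply, smul_eq_mul]
  simp only [Matrix.mulVec, dotProduct, projMatrix, Matrix.of_apply]
  exact Finset.sum_congr rfl fun b _ => mul_comm _ _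

/-- Centering preserves symmetry and the zero diagonal, so no information is lost in passing to the
upper triangle and applications of `𝐌` can be iterated. -/
lemma symmOfUpper_projMatrix_mulVec {n : ℕ} (c : IdxPair n → ℝ) :
    symmOfUpper (projMatrix n *ᵥ c) = uCenter (symmOfUpper c) := by
  rw [← eq_symmOfUpper (uCenter_symm (symmOfUpper_symm c)) (uCenter_diag (symmOfUpper c))]
  congr 1
  ext a
  exact projMatrix_mulVec c a

lemma projMatrix_mul_self {n : ℕ} (hn : 3 ≤ n) : projMatrix n * projMatrix n = projMatrix n := by
  apply Matrix.toLin'.injective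
  refine LinearMap.ext fun c => ?_
  ext a
  rw [Matrix.toLin'_apply, Matrix.toLin'_apply, ← Matrix.mulVec_mulVec, projMatrix_mulVec,
    symmOfUpper_projMatrix_mulVec, uCenter_uCenter hn (symmOfUpper_symm c) (symmOfUpper_diag c),
    projMatrix_mulVec]

/-- The entry depends only on which indices the two pairs share; this makes the symmetry of `𝐌` and
its diagonal visible. -/
lemma projMatrix_apply {n : ℕ} (a b : IdxPair n) :
    projMatrix n a b =
      ((if b.1.1 = a.1.1 ∧ b.1.2 = a.1.2 then 1 else 0)
        + (if b.1.2 = a.1.1 ∧ b.1.1 = a.1.2 then 1 else 0))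
      - 1 / ((n : ℝ) - 2) * ((if b.1.1 = a.1.1 then 1 else 0) + (if b.1.2 = a.1.1 then 1 else 0))
      - 1 / ((n : ℝ) - 2) * ((if b.1.2 = a.1.2 then 1 else 0) + (if b.1.1 = a.1.2 then 1 else 0))
      + 1 / (((n : ℝ) - 1) * ((n : ℝ) - 2)) * 2 := by
  simp only [projMatrix, Matrix.of_apply, uCenter_apply, a.2.ne, if_false, Matrix.add_apply,
    Matrix.single_apply, Finset.sum_add_distrib]
  have h : ∀ u w : Fin n, ∑ x, ∑ y, (if u = x ∧ w = y then (1 : ℝ) else 0) = 1 := fun u w => by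
    simp [ite_and, Finset.sum_ite_irrel]
  rw [h, h]
  norm_num [ite_and, Finset.sum_ite_irrel]

lemma projMatrix_transpose (n : ℕ) : (projMatrix n)ᵀ = projMatrix n := by
  ext a b
  rw [Matrix.transpose_apply, projMatrix_apply, projMatrix_apply]
  obtain ⟨⟨s, t⟩, hst⟩ := a
  obtain ⟨⟨u, w⟩, huw⟩ := b
  simp only [eq_comm (a := s), eq_comm (a := t), and_comm (a := u = t)]
  ring

/-! ### Trace, rank and the quadratic form of `𝐌` -/

lemma sum_offDiag_eq {n : ℕ} (F : Fin n → Fin n → ℝ) (hF : ∀ s t, F s t = F t s) :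
    ∑ s, ∑ t, (if s = t then 0 else F s t) = 2 * ∑ a : IdxPair n, F a.1.1 a.1.2 := by
  have h1 : ∑ a : IdxPair n, F a.1.1 a.1.2 = ∑ s, ∑ t, if s < t then F s t else 0 := by
    rw [← Fintype.sum_prod_type' (f := fun s t => if s < t then F s t else 0),
      ← Finset.sum_filter]
    exact (Finset.sum_subtype (Finset.univ.filter fun a : Fin n × Fin n => a.1 < a.2)
      (by simp) fun a => F a.1 a.2).symm
  have h2 : ∑ s, ∑ t, (if s < t then F s t else 0) = ∑ s, ∑ t, if t < s then F s t else 0 := by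
    rw [Finset.sum_comm]
    exact Finset.sum_congr rfl fun s _ => Finset.sum_congr rfl fun t _ => by rw [hF]
  rw [two_mul, h1]
  nth_rw 2 [h2]
  simp only [← Finset.sum_add_distrib]
  refine Finset.sum_congr rfl fun s _ => Finset.sum_congr rfl fun t _ => ?_
  rcases lt_trichotomy s t with h | h | h
  · simp [h, h.ne, h.not_gt]
  · simp [h]
  · simp [h, h.ne', h.not_gt]

lemma two_mul_card_idxPair (n : ℕ) :
    2 * (Fintype.card (IdxPair n) : ℝ) = (n : ℝ) * ((n : ℝ) - 1) := by
  have h := sum_offDiag_eq (n := n) (fun _ _ => 1) (fun _ _ => rfl)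
  simp only [Finset.sum_const, Finset.card_univ, nsmul_eq_mul, mul_one] at h
  rw [← h]
  have : ∀ s t : Fin n, (if s = t then (0 : ℝ) else 1) = 1 - if s = t then 1 else 0 := by
    intro s t
    split_ifs <;> simp
  simp only [this, Finset.sum_sub_distrib, Finset.sum_ite_eq, Finset.mem_univ, if_true,
    Finset.sum_const, Finset.card_univ, Fintype.card_fin, nsmul_eq_mul]
  ring

lemma projMatrix_trace {n : ℕ} (hn : 3 ≤ n) :
    2 * (projMatrix n).trace = (n : ℝ) * ((n : ℝ) - 3) := by
  have hn' : (3 : ℝ) ≤ n := by exact_mod_cast hn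
  have h1 : (n : ℝ) - 1 ≠ 0 := by linarith
  have h2 : (n : ℝ) - 2 ≠ 0 := by linarith
  -- The diagonal entry is `1 - 2/(n-2) + 2/((n-1)(n-2))`.
  have hd : ∀ a : IdxPair n, projMatrix n a a = ((n : ℝ) - 3) / ((n : ℝ) - 1) := by
    intro a
    rw [projMatrix_apply]
    simp only [a.2.ne, a.2.ne', and_self, if_true, if_false]
    field_simp
    ring
  simp only [Matrix.trace, Matrix.diag, hd, Finset.sum_const, Finset.card_univ, nsmul_eq_mul]
  rw [← mul_assoc, two_mul_card_idxPair]
  field_simp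

/-- An idempotent is a projection onto its range, and the trace of a projection is the dimension of
its range. -/
lemma Matrix.rank_eq_trace_of_isIdempotentElem {ι : Type*} [Fintype ι] [DecidableEq ι]
    {A : Matrix ι ι ℝ} (hA : A * A = A) : (A.rank : ℝ) = A.trace := by
  have hi : IsIdempotentElem (Matrix.toLin' A) := by
    rw [IsIdempotentElem, Module.End.mul_eq_comp, ← Matrix.toLin'_mul, hA]
  have := (LinearMap.IsIdempotentElem.isProj_range _ hi).trace
  rw [Matrix.trace_toLin'_eq] at this
  rw [this]
  rfl

/-- Natural-number division and subtraction are exact here: `n` and `n - 3` have opposite parity,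
and `n ≥ 4`. -/
lemma two_mul_natCast_half {n v : ℕ} (hn : 4 ≤ n) (hv : v = n * (n - 3) / 2) :
    2 * (v : ℝ) = (n : ℝ) * ((n : ℝ) - 3) := by
  have h : 2 * v = n * (n - 3) := by
    rw [hv]
    apply Nat.mul_div_cancel'
    obtain ⟨m, rfl⟩ := Nat.exists_eq_add_of_le hn
    rw [show 4 + m - 3 = m + 1 by omega, ← even_iff_two_dvd]
    rcases Nat.even_or_odd m with h | h <;> simp [Nat.even_add, h, parity_simps]
  rw [show ((n : ℝ) - 3) = ((n - 3 : ℕ) : ℝ) by push_cast [show 3 ≤ n by omega]; ring]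
  exact_mod_cast h

lemma projMatrix_rank {n v : ℕ} (hn : 4 ≤ n) (hv : v = n * (n - 3) / 2) :
    (projMatrix n).rank = v := by
  have h1 := Matrix.rank_eq_trace_of_isIdempotentElem (projMatrix_mul_self (n := n) (by omega))
  have h2 := projMatrix_trace (n := n) (by omega)
  have h3 := two_mul_natCast_half hn hv
  have : ((projMatrix n).rank : ℝ) = v := by linarith
  exact_mod_cast this

/-- Ordered pairs count each `s < t` twice, which turns `1/(n(n-3)) = 1/(2v)` into `1/v`; and `Mc ·
Md = c · Md` because `𝐌` is symmetric and idempotent. -/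
lemma uInner_uCenter_symmOfUpper {n v : ℕ} (hn : 4 ≤ n) (hv : v = n * (n - 3) / 2)
    (c d : IdxPair n → ℝ) :
    uInner (uCenter (symmOfUpper c)) (uCenter (symmOfUpper d)) =
      1 / (v : ℝ) * (c ⬝ᵥ (projMatrix n *ᵥ d)) := by
  have h3 := two_mul_natCast_half hn hv
  have hM : c ⬝ᵥ (projMatrix n *ᵥ d) = ∑ a, (projMatrix n *ᵥ c) a * (projMatrix n *ᵥ d) a := by
    change _ = (projMatrix n *ᵥ c) ⬝ᵥ (projMatrix n *ᵥ d)
    rw [Matrix.dotProduct_mulVec (projMatrix n *ᵥ c), ← Matrix.mulVec_transpose,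
      projMatrix_transpose, Matrix.mulVec_mulVec, projMatrix_mul_self (by omega),
      Matrix.dotProduct_mulVec c, ← Matrix.mulVec_transpose, projMatrix_transpose]
  rw [uInner, sum_offDiag_eq _ fun s t => by
    rw [uCenter_symm (symmOfUpper_symm c), uCenter_symm (symmOfUpper_symm d)], ← h3, hM]
  simp only [projMatrix_mulVec]
  have : (v : ℝ) ≠ 0 := by
    have : (4 : ℝ) ≤ n := by exact_mod_cast hn
    nlinarith
  field_simp

lemma uInner_sum_sum {n : ℕ} {ι κ : Type*} (s : Finset ι) (t : Finset κ)
    (A : ι → Matrix (Fin n) (Fin n) ℝ) (B : κ → Matrix (Fin n) (Fin n) ℝ) :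
    uInner (∑ i ∈ s, A i) (∑ j ∈ t, B j) = ∑ i ∈ s, ∑ j ∈ t, uInner (A i) (B j) := by
  simp only [uInner, ← Finset.mul_sum]
  congr 1
  symm
  calc ∑ i ∈ s, ∑ j ∈ t, ∑ u, ∑ w, (if u = w then 0 else A i u w * B j u w)
      = ∑ i ∈ s, ∑ u, ∑ w, ∑ j ∈ t, (if u = w then 0 else A i u w * B j u w) := by
        refine Finset.sum_congr rfl fun i _ => ?_
        rw [Finset.sum_comm]
        exact Finset.sum_congr rfl fun u _ => Finset.sum_comm
    _ = ∑ u, ∑ w, ∑ i ∈ s, ∑ j ∈ t, (if u = w then 0 else A i u w * B j u w) := by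
        rw [Finset.sum_comm]
        exact Finset.sum_congr rfl fun u _ => Finset.sum_comm
    _ = _ := by
        refine Finset.sum_congr rfl fun u _ => Finset.sum_congr rfl fun w _ => ?_
        split_ifs with h
        · simp
        · rw [Matrix.sum_apply, Matrix.sum_apply, Finset.sum_mul_sum]

lemma uInner_smul_smul {n : ℕ} (α β : ℝ) (A B : Matrix (Fin n) (Fin n) ℝ) :
    uInner (α • A) (β • B) = α * β * uInner A B := by
  simp only [uInner, Finset.mul_sum]
  refine Finset.sum_congr rfl fun s _ => Finset.sum_congr rfl fun t _ => ?_
  split_ifs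
  · simp
  · simp only [Matrix.smul_apply, smul_eq_mul]
    ring

/-! ### The statistic as a bilinear form in the scaled sums -/

section DoubleCentered

variable {Ω : Type*} [MeasurableSpace Ω] {n p q : ℕ} (μ : Measure Ω)

lemma doubleCentered_diag (k : ℝ → ℝ → ℝ) (x : Fin n → Ω → ℝ) (ω : Ω) (s : Fin n) :
    doubleCentered μ k x ω s s = 0 := by
  simp [doubleCentered]

lemma doubleCentered_of_ne (k : ℝ → ℝ → ℝ) (x : Fin n → Ω → ℝ) (ω : Ω) {s t : Fin n}
    (hst : s ≠ t) : doubleCentered μ k x ω s t = k (x s ω) (x t ω)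
      - (μ[fun ω' => k (x s ω') (x t ω') | MeasurableSpace.comap (x s) inferInstance]) ω
      - (μ[fun ω' => k (x s ω') (x t ω') | MeasurableSpace.comap (x t) inferInstance]) ω
      + ∫ ω', k (x s ω') (x t ω') ∂μ := by
  simp [doubleCentered, hst]

lemma doubleCentered_symm {k : ℝ → ℝ → ℝ} (hk : IsKernel k) (x : Fin n → Ω → ℝ) (ω : Ω)
    (s t : Fin n) : doubleCentered μ k x ω s t = doubleCentered μ k x ω t s := by
  by_cases hst : s = t
  · rw [hst]
  · rw [doubleCentered_of_ne _ _ _ _ hst, doubleCentered_of_ne _ _ _ _ (Ne.symm hst)]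
    simp only [hk.symm (x t _) (x s _)]
    ring

lemma symmOfUpper_scaledSum {k : ℝ → ℝ → ℝ} (hk : IsKernel k) (X : Fin n → Fin p → Ω → ℝ) (ω : Ω) :
    symmOfUpper (scaledSum μ k X ω) =
      (1 / Real.sqrt (p : ℝ)) • ∑ i, doubleCentered μ k (fun s => X s i) ω := by
  rw [← eq_symmOfUpper (A := (1 / Real.sqrt (p : ℝ)) • ∑ i, doubleCentered μ k (fun s => X s i) ω)]
  · congr 1
    ext a
    simp [scaledSum, Matrix.sum_apply]
  · intro s t
    simp only [Matrix.smul_apply, Matrix.sum_apply]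
    congr 1
    exact Finset.sum_congr rfl fun i _ => doubleCentered_symm μ hk _ ω s t
  · intro s
    simp [Matrix.sum_apply, doubleCentered_diag]

lemma uCov_eq {v : ℕ} (hn : 4 ≤ n) (hv : v = n * (n - 3) / 2) {k l : ℝ → ℝ → ℝ}
    (hk : IsKernel k) (hl : IsKernel l) (X : Fin n → Fin p → Ω → ℝ) (Y : Fin n → Fin q → Ω → ℝ)
    (ω : Ω) : uCov μ k l X Y ω =
      1 / (v : ℝ) * (scaledSum μ k X ω ⬝ᵥ (projMatrix n *ᵥ scaledSum μ l Y ω)) := by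
  rw [← uInner_uCenter_symmOfUpper hn hv, symmOfUpper_scaledSum μ hk, symmOfUpper_scaledSum μ hl,
    uCenter_smul, uCenter_smul, uInner_smul_smul, uCenter_sum, uCenter_sum, uInner_sum_sum, uCov,
    Real.sqrt_mul (Nat.cast_nonneg p)]
  congr 1
  rw [div_mul_div_comm, one_mul]

end DoubleCentered

/-! ### Orthogonality of double centered kernels at distinct pairs -/

section CondExp

variable {Ω : Type*} [mΩ : MeasurableSpace Ω] {μ : Measure Ω} [IsProbabilityMeasure μ]

/-- If `B` is independent of `A`, conditioning `f (A, B)` on `A` integrates out `B`. -/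
lemma condExp_ae_eq_integral_map_of_indepFun {α : Type*} [mα : MeasurableSpace α] {A : Ω → α}
    {B : Ω → ℝ} (hA : Measurable A) (hB : Measurable B) (hAB : IndepFun A B μ) {f : α × ℝ → ℝ}
    (hf : Measurable f) (hint : Integrable (fun ω => f (A ω, B ω)) μ) :
    μ[fun ω => f (A ω, B ω) | mα.comap A] =ᵐ[μ] fun ω => ∫ b, f (A ω, b) ∂(μ.map B) := by
  have : IsProbabilityMeasure (μ.map B) := Measure.isProbabilityMeasure_map hB.aemeasurable
  have h1 := condExp_prod_ae_eq_integral_condDistrib hA hB.aemeasurable hf.stronglyMeasurable hint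
  have h2 : condDistrib B A μ =ᵐ[μ.map A] Kernel.const α (μ.map B) := by
    refine condDistrib_ae_eq_of_measure_eq_compProd A hB.aemeasurable ?_
    rw [Measure.compProd_const]
    exact (indepFun_iff_map_prod_eq_prod_map_map hA.aemeasurable hB.aemeasurable).1 hAB
  filter_upwards [h1, ae_of_ae_map hA.aemeasurable h2] with ω h1 h2
  rw [h1, h2, Kernel.const_apply]

/-- Tower property: condition on `m` and pull out `g`. -/
lemma integral_mul_eq_zero_of_condExp_ae_eq_zero {m : MeasurableSpace Ω} (hm : m ≤ mΩ) {f g : Ω → ℝ}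
    (hf : Integrable f μ) (h0 : μ[f | m] =ᵐ[μ] 0) (hg : StronglyMeasurable[m] g)
    (hfg : Integrable (f * g) μ) : ∫ ω, f ω * g ω ∂μ = 0 := by
  have h := condExp_mul_of_stronglyMeasurable_right (m := m) hg hfg hf
  change ∫ ω, (f * g) ω ∂μ = 0
  rw [← integral_condExp hm, integral_congr_ae h]
  apply integral_eq_zero_of_ae
  filter_upwards [h0] with ω h0
  simp [h0]

variable {n : ℕ}

lemma integrable_doubleCentered {k : ℝ → ℝ → ℝ} {x : Fin n → Ω → ℝ} {s t : Fin n}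
    (hint : Integrable (fun ω => k (x s ω) (x t ω)) μ) :
    Integrable (fun ω => doubleCentered μ k x ω s t) μ := by
  by_cases hst : s = t
  · simp [hst, doubleCentered_diag]
  · simp only [doubleCentered_of_ne μ k x _ hst]
    exact ((hint.sub integrable_condExp).sub integrable_condExp).add (integrable_const _)

/-- All four terms have the same mean and enter with signs `+, -, -, +`; independence plays no role.
-/
lemma integral_doubleCentered {k : ℝ → ℝ → ℝ} {x : Fin n → Ω → ℝ} (hx : ∀ s, Measurable (x s))
    {s t : Fin n} (hint : Integrable (fun ω => k (x s ω) (x t ω)) μ) :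
    ∫ ω, doubleCentered μ k x ω s t ∂μ = 0 := by
  by_cases hst : s = t
  · simp [hst, doubleCentered_diag]
  · simp only [doubleCentered_of_ne μ k x _ hst]
    set g := μ[fun ω => k (x s ω) (x t ω) | MeasurableSpace.comap (x s) inferInstance] with hg
    set h := μ[fun ω => k (x s ω) (x t ω) | MeasurableSpace.comap (x t) inferInstance] with hh
    have hg' : Integrable g μ := integrable_condExp
    have hh' : Integrable h μ := integrable_condExp
    have hgm : ∫ ω, g ω ∂μ = ∫ ω, k (x s ω) (x t ω) ∂μ := integral_condExp (hx s).comap_le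
    have hhm : ∫ ω, h ω ∂μ = ∫ ω, k (x s ω) (x t ω) ∂μ := integral_condExp (hx t).comap_le
    rw [integral_add (by exact (hint.sub hg').sub hh') (integrable_const _),
      integral_sub (by exact hint.sub hg') hh', integral_sub hint hg', hgm, hhm]
    simp

/-- Given all data that enters through a variable `U` independent of `x_t` and determining `x_s`,
the double centered kernel `k_{st}` has conditional mean zero. -/
lemma condExp_doubleCentered_ae_eq_zero {k : ℝ → ℝ → ℝ} (hk : IsKernel k) {x : Fin n → Ω → ℝ}
    (hx : ∀ s, Measurable (x s)) {s t : Fin n} (hst : s ≠ t)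
    (hint : Integrable (fun ω => k (x s ω) (x t ω)) μ)
    {α : Type*} [mα : MeasurableSpace α] {U : Ω → α} (hU : Measurable U)
    (hind : IndepFun U (x t) μ) {φ : α → ℝ} (hφ : Measurable φ) (hs : ∀ ω, x s ω = φ (U ω)) :
    μ[fun ω => doubleCentered μ k x ω s t | mα.comap U] =ᵐ[μ] 0 := by
  have hsU : (inferInstance : MeasurableSpace ℝ).comap (x s) ≤ mα.comap U := by
    have : x s = φ ∘ U := funext hs
    rw [this, ← MeasurableSpace.comap_comp]
    exact MeasurableSpace.comap_mono hφ.comap_le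
  have hind' : IndepFun (x s) (x t) μ := by
    have : x s = φ ∘ U := funext hs
    rw [this]
    exact hind.comp hφ measurable_id
  -- Given `U`, the four terms cancel in pairs: conditioning the kernel on `U` or on `x_s` only
  -- integrates out `x_t`, while `E[k | x_t]` is independent of `U` and becomes the constant `E k`.
  have h1 : μ[fun ω => k (x s ω) (x t ω) | mα.comap U] =ᵐ[μ]
      fun ω => ∫ b, k (x s ω) b ∂(μ.map (x t)) := by
    simp only [hs] at hint ⊢
    exact condExp_ae_eq_integral_map_of_indepFun (f := fun z => k (φ z.1) z.2) hU (hx t) hind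
      (hk.measurable.comp ((hφ.comp measurable_fst).prodMk measurable_snd)) hint
  have h2 : μ[fun ω => k (x s ω) (x t ω) | MeasurableSpace.comap (x s) inferInstance] =ᵐ[μ]
      fun ω => ∫ b, k (x s ω) b ∂(μ.map (x t)) :=
    condExp_ae_eq_integral_map_of_indepFun (f := fun z => k z.1 z.2) (hx s) (hx t) hind'
      hk.measurable hint
  set g := μ[fun ω => k (x s ω) (x t ω) | MeasurableSpace.comap (x s) inferInstance] with hg
  set h := μ[fun ω => k (x s ω) (x t ω) | MeasurableSpace.comap (x t) inferInstance] with hh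
  have hgU : μ[g | mα.comap U] = g :=
    condExp_of_stronglyMeasurable hU.comap_le (stronglyMeasurable_condExp.mono hsU)
      integrable_condExp
  have hhU : μ[h | mα.comap U] =ᵐ[μ] fun _ => μ[h] :=
    condExp_indep_eq (hx t).comap_le hU.comap_le stronglyMeasurable_condExp
      ((IndepFun_iff_Indep _ _ _).1 hind.symm)
  have hm : μ[h] = ∫ ω, k (x s ω) (x t ω) ∂μ := integral_condExp (hx t).comap_le
  have hdc : (fun ω => doubleCentered μ k x ω s t) =
      (((fun ω => k (x s ω) (x t ω)) - g) - h) + fun _ => ∫ ω', k (x s ω') (x t ω') ∂μ :=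
    funext fun ω => doubleCentered_of_ne μ k x ω hst
  have hg' : Integrable g μ := integrable_condExp
  have hh' : Integrable h μ := integrable_condExp
  have a1 := condExp_add ((hint.sub hg').sub hh')
    (integrable_const (μ := μ) (∫ ω', k (x s ω') (x t ω') ∂μ)) (mα.comap U)
  have a2 := condExp_sub (hint.sub hg') hh' (mα.comap U)
  have a3 := condExp_sub hint hg' (mα.comap U)
  rw [condExp_const hU.comap_le] at a1
  rw [hdc]
  filter_upwards [a1, a2, a3, h1, h2, hhU] with ω a1 a2 a3 h1 h2 hhU
  rw [a1, Pi.add_apply, a2, Pi.sub_apply, a3, Pi.sub_apply, h1, hgU, h2, hhU, hm]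
  simp

lemma stronglyMeasurable_doubleCentered {l : ℝ → ℝ → ℝ} (hl : IsKernel l) {y : Fin n → Ω → ℝ}
    {u w : Fin n} {α : Type*} [mα : MeasurableSpace α] {U : Ω → α}
    (hu : Measurable[mα.comap U] (y u)) (hw : Measurable[mα.comap U] (y w)) :
    StronglyMeasurable[mα.comap U] (fun ω => doubleCentered μ l y ω u w) := by
  by_cases huw : u = w
  · simp only [huw, doubleCentered_diag]
    exact stronglyMeasurable_const
  · simp only [doubleCentered_of_ne μ l y _ huw]
    refine StronglyMeasurable.add (StronglyMeasurable.sub (StronglyMeasurable.sub ?_ ?_) ?_) ?_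
    · exact (hl.measurable.comp (hu.prodMk hw)).stronglyMeasurable
    · exact stronglyMeasurable_condExp.mono hu.comap_le
    · exact stronglyMeasurable_condExp.mono hw.comap_le
    · exact stronglyMeasurable_const

/-- Double centered kernels of coordinates of an independent sample at two pairs of indices are
uncorrelated as soon as one index of the first pair does not occur in the second one. -/
lemma integral_doubleCentered_mul_of_notMem {E : Type*} [MeasurableSpace E] {D : Fin n → Ω → E}
    (hD : iIndepFun D μ) (hDm : ∀ s, Measurable (D s)) {f g : E → ℝ} (hf : Measurable f)
    (hg : Measurable g) {k l : ℝ → ℝ → ℝ} (hk : IsKernel k) (hl : IsKernel l)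
    {s t u w : Fin n} (hst : s ≠ t) (hut : u ≠ t) (hwt : w ≠ t)
    (hint : Integrable (fun ω => k (f (D s ω)) (f (D t ω))) μ)
    (hkL : MemLp (fun ω => doubleCentered μ k (fun s ω => f (D s ω)) ω s t) 2 μ)
    (hlL : MemLp (fun ω => doubleCentered μ l (fun s ω => g (D s ω)) ω u w) 2 μ) :
    ∫ ω, doubleCentered μ k (fun s ω => f (D s ω)) ω s t
      * doubleCentered μ l (fun s ω => g (D s ω)) ω u w ∂μ = 0 := by
  -- Condition on all observations except the `t`-th: they determine `x_s` and the whole second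
  -- factor.
  let S : Finset (Fin n) := {t}ᶜ
  let U : Ω → S → E := fun ω i => D i ω
  have hmem : ∀ i : Fin n, i ≠ t → i ∈ S := fun i hi => by simp [S, hi]
  have hU : Measurable U := measurable_pi_lambda _ fun i => hDm i
  have hind : IndepFun U (fun ω => f (D t ω)) μ := by
    have h := hD.indepFun_finset S {t} (by simp [S]) hDm
    exact h.comp (φ := id) (ψ := fun z : (({t} : Finset (Fin n)) → E) =>
      f (z ⟨t, Finset.mem_singleton_self t⟩)) measurable_id (hf.comp (measurable_pi_apply _))
  have hcoord : ∀ i : Fin n, i ≠ t →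
      Measurable[MeasurableSpace.comap U inferInstance] (fun ω => g (D i ω)) := by
    intro i hi
    have h : Measurable (fun z : S → E => g (z ⟨i, hmem i hi⟩)) := hg.comp (measurable_pi_apply _)
    exact h.comp (comap_measurable U)
  refine integral_mul_eq_zero_of_condExp_ae_eq_zero hU.comap_le
    (integrable_doubleCentered (x := fun s ω => f (D s ω)) hint)
    (condExp_doubleCentered_ae_eq_zero hk (fun s => hf.comp (hDm s)) hst hint hU hind
      (φ := fun z => f (z ⟨s, hmem s hst⟩)) (hf.comp (measurable_pi_apply _)) fun ω => rfl)
    (stronglyMeasurable_doubleCentered hl (hcoord u hut) (hcoord w hwt)) ?_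
  exact hkL.integrable_mul hlL

/-- Double centered kernels of coordinates of an independent sample at two distinct pairs of indices
are uncorrelated. -/
lemma integral_doubleCentered_mul_of_ne {E : Type*} [MeasurableSpace E] {D : Fin n → Ω → E}
    (hD : iIndepFun D μ) (hDm : ∀ s, Measurable (D s)) {f g : E → ℝ} (hf : Measurable f)
    (hg : Measurable g) {k l : ℝ → ℝ → ℝ} (hk : IsKernel k) (hl : IsKernel l)
    {a b : IdxPair n} (hab : a ≠ b)
    (hint : Integrable (fun ω => k (f (D a.1.1 ω)) (f (D a.1.2 ω))) μ)
    (hkL : MemLp (fun ω => doubleCentered μ k (fun s ω => f (D s ω)) ω a.1.1 a.1.2) 2 μ)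
    (hlL : MemLp (fun ω => doubleCentered μ l (fun s ω => g (D s ω)) ω b.1.1 b.1.2) 2 μ) :
    ∫ ω, doubleCentered μ k (fun s ω => f (D s ω)) ω a.1.1 a.1.2
      * doubleCentered μ l (fun s ω => g (D s ω)) ω b.1.1 b.1.2 ∂μ = 0 := by
  obtain ⟨⟨s, t⟩, hst⟩ := a
  obtain ⟨⟨u, w⟩, huw⟩ := b
  simp only at hst huw hint hkL hlL ⊢
  -- If both `s` and `t` occurred in `(u, w)`, the orderings `s < t` and `u < w` would force the
  -- pairs to be equal.
  have hcases : (u ≠ t ∧ w ≠ t) ∨ (u ≠ s ∧ w ≠ s) := by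
    simp only [ne_eq, Subtype.mk.injEq, Prod.mk.injEq] at hab
    grind
  rcases hcases with ⟨h1, h2⟩ | ⟨h1, h2⟩
  · exact integral_doubleCentered_mul_of_notMem hD hDm hf hg hk hl hst.ne h1 h2 hint hkL hlL
  · simp only [doubleCentered_symm μ hk _ _ s t] at hkL ⊢
    simp only [hk.symm (f (D s _))] at hint
    exact integral_doubleCentered_mul_of_notMem hD hDm hf hg hk hl hst.ne' h1 h2 hint hkL hlL

end CondExp

/-! ### Moments of a limit in distribution -/

lemma integral_add_const_mul_sq {Ω : Type*} [MeasurableSpace Ω] {ν : Measure Ω} {f g : Ω → ℝ}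
    (ε : ℝ) (hf : MemLp f 2 ν) (hg : MemLp g 2 ν) :
    ∫ ω, (f ω + ε * g ω) ^ 2 ∂ν =
      ∫ ω, f ω ^ 2 ∂ν + 2 * ε * ∫ ω, f ω * g ω ∂ν + ε ^ 2 * ∫ ω, g ω ^ 2 ∂ν := by
  have hf2 : Integrable (fun ω => f ω ^ 2) ν := hf.integrable_sq
  have hfg : Integrable (fun ω => 2 * ε * (f ω * g ω)) ν := (hf.integrable_mul hg).const_mul _
  have hg2 : Integrable (fun ω => ε ^ 2 * g ω ^ 2) ν := hg.integrable_sq.const_mul _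
  have he : ∀ ω, (f ω + ε * g ω) ^ 2 = f ω ^ 2 + 2 * ε * (f ω * g ω) + ε ^ 2 * g ω ^ 2 :=
    fun ω => by ring
  simp only [he]
  rw [integral_add (by exact hf2.add hfg) hg2, integral_add hf2 hfg, integral_const_mul,
    integral_const_mul]

section LimitMoments

variable {R : Type*} {Ω : R → Type*} [∀ r, MeasurableSpace (Ω r)] {μ : (r : R) → Measure (Ω r)}
  [∀ r, IsProbabilityMeasure (μ r)] {Ω' : Type*} [MeasurableSpace Ω'] {μ' : Measure Ω'}
  [IsProbabilityMeasure μ'] {F : Filter R} [F.NeBot]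

/-- Fatou's lemma for second moments under convergence in distribution. -/
lemma integral_sq_le_of_tendstoInDistribution {Z : (r : R) → Ω r → ℝ} {W : Ω' → ℝ}
    (h : TendstoInDistribution Z F W μ μ') (hZ : ∀ r, MemLp (Z r) 2 (μ r)) (hW : MemLp W 2 μ')
    {A : ℝ} (hA : Tendsto (fun r => ∫ ω, Z r ω ^ 2 ∂(μ r)) F (𝓝 A)) :
    ∫ ω, W ω ^ 2 ∂μ' ≤ A := by
  -- The square is unbounded, so convergence in law is tested on `min (x²) K`, which lies below `x²`
  -- and tends to it as `K` grows.
  let f : ℕ → BoundedContinuousFunction ℝ ℝ := fun K =>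
    BoundedContinuousFunction.ofNormedAddCommGroup (fun x : ℝ => min (x ^ 2) (K : ℝ))
      (by fun_prop) K fun x => by
        rw [Real.norm_of_nonneg (le_min (sq_nonneg x) (Nat.cast_nonneg K))]
        exact min_le_right _ _
  have hf : ∀ K x, f K x = min (x ^ 2) (K : ℝ) := fun _ _ => rfl
  have hle : ∀ K, ∫ ω, f K (W ω) ∂μ' ≤ A := by
    intro K
    have ht := (ProbabilityMeasure.tendsto_iff_forall_integral_tendsto.1 h.tendsto) (f K)
    simp only [ProbabilityMeasure.coe_mk] at ht
    rw [integral_map h.aemeasurable_limit (f K).continuous.aestronglyMeasurable] at ht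
    refine le_of_tendsto_of_tendsto' ht hA fun r => ?_
    rw [integral_map (h.forall_aemeasurable r) (f K).continuous.aestronglyMeasurable]
    refine integral_mono_of_nonneg (ae_of_all _ fun ω => ?_) (hZ r).integrable_sq
      (ae_of_all _ fun ω => ?_)
    · exact le_min (sq_nonneg _) (Nat.cast_nonneg K)
    · exact min_le_left _ _
  have hlim : Tendsto (fun K => ∫ ω, f K (W ω) ∂μ') atTop (𝓝 (∫ ω, W ω ^ 2 ∂μ')) := by
    refine tendsto_integral_of_dominated_convergence (fun ω => W ω ^ 2) (fun K => ?_)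
      hW.integrable_sq (fun K => ae_of_all _ fun ω => ?_) (ae_of_all _ fun ω => ?_)
    · exact (f K).continuous.comp_aestronglyMeasurable hW.1
    · rw [hf, Real.norm_of_nonneg (le_min (sq_nonneg _) (Nat.cast_nonneg K))]
      exact min_le_left _ _
    · obtain ⟨N, hN⟩ := exists_nat_ge (W ω ^ 2)
      refine tendsto_const_nhds.congr' ?_
      filter_upwards [eventually_ge_atTop N] with K hK
      rw [hf, min_eq_left (hN.trans (by exact_mod_cast hK))]
  exact le_of_tendsto' hlim hle

variable {ι : Type*} [Finite ι]

/-- If the second moments of the coordinates converge to the variances of the limit in distribution,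
then the limit is centered, and orthogonal coordinates become uncorrelated in the limit. -/
lemma centered_and_uncorrelated_of_tendstoInDistribution {S : (r : R) → Ω r → ι → ℝ}
    {Z : Ω' → ι → ℝ} (h : TendstoInDistribution S F Z μ μ')
    (hS : ∀ r i, MemLp (fun ω => S r ω i) 2 (μ r)) (hZ : ∀ i, MemLp (fun ω => Z ω i) 2 μ')
    (hlim : ∀ i, Tendsto (fun r => ∫ ω, S r ω i ^ 2 ∂(μ r)) F (𝓝 (Var[fun ω => Z ω i; μ']))) :
    (∀ i, ∫ ω, Z ω i ∂μ' = 0) ∧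
      ∀ i j, (∀ r, ∫ ω, S r ω i * S r ω j ∂(μ r) = 0) →
        cov[fun ω => Z ω i, fun ω => Z ω j; μ'] = 0 := by
  have hvar : ∀ i, Var[fun ω => Z ω i; μ'] = ∫ ω, Z ω i ^ 2 ∂μ' - (∫ ω, Z ω i ∂μ') ^ 2 :=
    fun i => variance_eq_sub (hZ i)
  have hmean : ∀ i, ∫ ω, Z ω i ∂μ' = 0 := by
    intro i
    have h1 := integral_sq_le_of_tendstoInDistribution
      (h.continuous_comp (g := fun z : ι → ℝ => z i) (continuous_apply i))
      (fun r => hS r i) (hZ i) (hlim i)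
    simp only [Function.comp_apply] at h1
    have h2 := hvar i
    exact pow_eq_zero_iff two_ne_zero |>.1 (le_antisymm (by linarith) (sq_nonneg _))
  refine ⟨hmean, fun i j hij => ?_⟩
  have hsq : ∀ i, ∫ ω, Z ω i ^ 2 ∂μ' = Var[fun ω => Z ω i; μ'] := fun i => by
    rw [hvar, hmean]; ring
  -- Fatou for `Z_i + ε Z_j`: the cross term vanishes before the limit, and the squares agree on
  -- both sides, so only the limiting cross term is left. The signs `ε = ±1` then suffice.
  have key : ∀ ε : ℝ, 2 * ε * ∫ ω, Z ω i * Z ω j ∂μ' ≤ 0 := by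
    intro ε
    have hc : Continuous fun z : ι → ℝ => z i + ε * z j := by fun_prop
    have h1 := integral_sq_le_of_tendstoInDistribution (A := Var[fun ω => Z ω i; μ']
      + ε ^ 2 * Var[fun ω => Z ω j; μ']) (h.continuous_comp hc)
      (fun r => (hS r i).add ((hS r j).const_mul ε)) ((hZ i).add ((hZ j).const_mul ε)) (by
        simp only [Function.comp_apply]
        refine ((hlim i).add ((hlim j).const_mul (ε ^ 2))).congr fun r => ?_
        rw [integral_add_const_mul_sq ε (hS r i) (hS r j), hij r]
        ring)
    simp only [Function.comp_apply] at h1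
    rw [integral_add_const_mul_sq ε (hZ i) (hZ j), hsq, hsq] at h1
    linarith
  have h1 := key 1
  have h2 := key (-1)
  rw [covariance_eq_sub (hZ i) (hZ j), hmean i]
  have : μ'[(fun ω => Z ω i) * fun ω => Z ω j] = ∫ ω, Z ω i * Z ω j ∂μ' := rfl
  rw [this]
  linarith

end LimitMoments

/-! ### Identification of centered Gaussian laws -/

section GaussianLaw

variable {Ω' : Type*} [MeasurableSpace Ω'] {μ' : Measure Ω'} {ι : Type*} [Fintype ι]

/-- The quadratic form of `S` at `x` is the variance of `∑ x_i Z_i`. -/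
lemma posSemidef_of_covariance [IsProbabilityMeasure μ'] {Z : Ω' → ι → ℝ}
    (hZ : ∀ i, MemLp (fun ω => Z ω i) 2 μ')
    {S : Matrix ι ι ℝ} (hcov : ∀ i j, cov[fun ω => Z ω i, fun ω => Z ω j; μ'] = S i j) :
    S.PosSemidef := by
  refine Matrix.PosSemidef.of_dotProduct_mulVec_nonneg ?_ fun x => ?_
  · ext i j
    rw [Matrix.conjTranspose_apply, star_trivial, ← hcov, ← hcov, covariance_comm]
  · have h : star x ⬝ᵥ (S *ᵥ x) = cov[fun ω => ∑ i, x i * Z ω i, fun ω => ∑ i, x i * Z ω i; μ'] := by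
      rw [covariance_fun_sum_fun_sum (fun i => (hZ i).const_mul (x i))
        (fun i => (hZ i).const_mul (x i))]
      simp only [covariance_const_mul_left, covariance_const_mul_right, hcov, dotProduct,
        Matrix.mulVec, Finset.mul_sum, star_trivial]
      exact Finset.sum_congr rfl fun i _ => Finset.sum_congr rfl fun j _ => by ring
    have hm : MemLp (fun ω => ∑ i, x i * Z ω i) 2 μ' :=
      memLp_finsetSum _ fun i _ => (hZ i).const_mul (x i)
    rw [h, covariance_self hm.aemeasurable]
    exact variance_nonneg _ _

/-- A centered Gaussian vector with covariance matrix `S` has law `N(0, S)`. -/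
lemma hasLaw_multivariateGaussian [IsProbabilityMeasure μ'] [DecidableEq ι] {Z : Ω' → ι → ℝ}
    (hZ : HasGaussianLaw Z μ') (hmean : ∀ i, ∫ ω, Z ω i ∂μ' = 0)
    {S : Matrix ι ι ℝ} (hcov : ∀ i j, cov[fun ω => Z ω i, fun ω => Z ω j; μ'] = S i j) :
    HasLaw (fun ω => WithLp.toLp 2 (Z ω)) (multivariateGaussian 0 S) μ' := by
  have hi : ∀ i, MemLp (fun ω => Z ω i) 2 μ' := fun i => (hZ.eval i).memLp_two
  have hS := posSemidef_of_covariance hi hcov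
  have hG : HasGaussianLaw (fun ω => WithLp.toLp 2 (Z ω)) μ' := hZ.toLp_pi 2
  refine ⟨hG.aemeasurable, ?_⟩
  have := hG.isGaussian_map
  -- A Gaussian measure is determined by its mean and its covariance form.
  refine IsGaussian.ext ?_ ?_
  · rw [integral_id_multivariateGaussian', integral_map hG.aemeasurable (by fun_prop)]
    ext i
    have h := (EuclideanSpace.proj (𝕜 := ℝ) i).integral_comp_comm hG.integrable
    simp only [id_eq]
    exact h.symm.trans (by simpa using hmean i)
  · ext x y
    rw [covarianceBilin_multivariateGaussian hS, covarianceBilin_apply_pi hi]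
    simp only [hcov, dotProduct, Matrix.mulVec, Finset.mul_sum]
    exact Finset.sum_congr rfl fun i _ => Finset.sum_congr rfl fun j _ => by ring

/-- A vector of uncorrelated jointly Gaussian centered variables of variance `σ2` is a scaled
standard Gaussian vector. -/
lemma hasLaw_pi_gaussianReal [DecidableEq ι] {Z : Ω' → ι → ℝ} (hZ : HasGaussianLaw Z μ') {σ2 : ℝ}
    (hmean : ∀ i, ∫ ω, Z ω i ∂μ' = 0)
    (hcov : ∀ i j, cov[fun ω => Z ω i, fun ω => Z ω j; μ'] = if i = j then σ2 else 0) :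
    HasLaw Z ((Measure.pi fun _ : ι => gaussianReal 0 1).map fun z i => Real.sqrt σ2 * z i) μ' := by
  -- Uncorrelated jointly Gaussian coordinates are independent, so the joint law is the product of
  -- the marginals. Writing these as images of `N(0, 1)` under scaling also covers `σ2 = 0`.
  have hind : iIndepFun (fun i ω => Z ω i) μ' :=
    HasGaussianLaw.iIndepFun_of_covariance_eq_zero (X := fun i ω => Z ω i) hZ
      fun i j hij => by rw [hcov, if_neg hij]
  have hlaw : ∀ i, HasLaw (fun ω => Z ω i)
      ((gaussianReal 0 1).map fun z => Real.sqrt σ2 * z) μ' := by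
    intro i
    have hG := hZ.eval i
    refine ⟨hG.aemeasurable, ?_⟩
    have hv : Var[fun ω => Z ω i; μ'] = σ2 := by
      rw [← covariance_self hG.aemeasurable, hcov, if_pos rfl]
    have hσ : 0 ≤ σ2 := hv ▸ variance_nonneg _ _
    have h := hG.map_eq_gaussianReal
    rw [hmean i, hv] at h
    rw [h, gaussianReal_map_const_mul]
    congr 1
    · simp
    · ext
      simp [Real.sq_sqrt hσ, hσ]
  have h := hind.hasLaw_pi hlaw
  have hpi := Measure.pi_map_pi (μ := fun _ : ι => gaussianReal 0 1)
    (f := fun (_ : ι) (z : ℝ) => Real.sqrt σ2 * z) fun _ => by fun_prop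
  rwa [← hpi] at h

end GaussianLaw

/-! ### Quadratic forms of projections and the chi-square law -/

section QuadraticForm

variable {ι : Type*} [Fintype ι]

/-- The quadratic form of an orthogonal projection of rank `v` is a sum of `v` squares of
orthonormal coordinates. -/
lemma exists_orthonormal_dotProduct_mulVec [DecidableEq ι] {M : Matrix ι ι ℝ} (hT : Mᵀ = M)
    (hM : M * M = M) {v : ℕ} (hv : M.rank = v) :
    ∃ u : Fin v → ι → ℝ, (∀ i j, u i ⬝ᵥ u j = if i = j then 1 else 0) ∧
      ∀ x, x ⬝ᵥ (M *ᵥ x) = ∑ i, (u i ⬝ᵥ x) ^ 2 := by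
  let K : Submodule ℝ (EuclideanSpace ℝ ι) := LinearMap.range (Matrix.toEuclideanLin M)
  have hK : Module.finrank ℝ K = v := by
    rw [← hv, Matrix.rank_eq_finrank_range_toLin M (EuclideanSpace.basisFun ι ℝ).toBasis
      (EuclideanSpace.basisFun ι ℝ).toBasis]
    rfl
  let b := (stdOrthonormalBasis ℝ K).reindex (finCongr hK)
  have hdot : ∀ x y : ι → ℝ, x ⬝ᵥ y = inner ℝ (WithLp.toLp 2 x) (WithLp.toLp 2 y) := fun x y => by
    rw [EuclideanSpace.inner_toLp_toLp, star_trivial, dotProduct_comm]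
  have hadj : ∀ x y : ι → ℝ, (M *ᵥ x) ⬝ᵥ y = x ⬝ᵥ (M *ᵥ y) := fun x y => by
    rw [Matrix.dotProduct_mulVec, ← Matrix.mulVec_transpose, hT]
  refine ⟨fun i => WithLp.ofLp (b i : EuclideanSpace ℝ ι), fun i j => ?_, fun x => ?_⟩
  · rw [hdot]
    exact (orthonormal_iff_ite.1 b.orthonormal) i j
  · have hx : WithLp.toLp 2 (M *ᵥ x) ∈ K := ⟨WithLp.toLp 2 x, rfl⟩
    -- Since `M` fixes its range, `⟨b_i, Mx⟩ = ⟨M b_i, x⟩ = ⟨b_i, x⟩`; Parseval for `xᵀMx = ‖Mx‖²`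
    -- then gives the sum of squares.
    have hfix : ∀ i, M *ᵥ WithLp.ofLp (b i : EuclideanSpace ℝ ι) =
        WithLp.ofLp (b i : EuclideanSpace ℝ ι) := by
      intro i
      obtain ⟨y, hy⟩ := (b i).2
      have hy' : M *ᵥ WithLp.ofLp y = WithLp.ofLp (b i : EuclideanSpace ℝ ι) :=
        congrArg WithLp.ofLp hy
      rw [← hy', Matrix.mulVec_mulVec, hM]
    have h1 := b.sum_sq_norm_inner_right ⟨WithLp.toLp 2 (M *ᵥ x), hx⟩
    have h2 : x ⬝ᵥ (M *ᵥ x) = ‖(⟨WithLp.toLp 2 (M *ᵥ x), hx⟩ : K)‖ ^ 2 := by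
      rw [← real_inner_self_eq_norm_sq]
      change _ = inner ℝ (WithLp.toLp 2 (M *ᵥ x)) (WithLp.toLp 2 (M *ᵥ x))
      rw [← hdot, hadj, Matrix.mulVec_mulVec, hM]
    rw [h2, ← h1]
    refine Finset.sum_congr rfl fun i _ => ?_
    rw [Real.norm_eq_abs, sq_abs]
    congr 1
    change inner ℝ (WithLp.toLp 2 (WithLp.ofLp (b i : EuclideanSpace ℝ ι)))
      (WithLp.toLp 2 (M *ᵥ x)) = _
    rw [← hdot, ← hadj, hfix]

variable {Ω' : Type*} [MeasurableSpace Ω'] {μ' : Measure Ω'}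

/-- The quadratic form of a rank `v` orthogonal projection in uncorrelated centered jointly Gaussian
variables of common variance is a scaled chi-square variable. -/
lemma hasLaw_chiSquare_quadraticForm [DecidableEq ι] {M : Matrix ι ι ℝ} (hT : Mᵀ = M)
    (hM : M * M = M) {v : ℕ} (hv : M.rank = v) {Z : Ω' → ι → ℝ} (hZ : HasGaussianLaw Z μ')
    {σ2 : ℝ} (hσ : 0 ≤ σ2) (hmean : ∀ i, ∫ ω, Z ω i ∂μ' = 0)
    (hcov : ∀ i j, cov[fun ω => Z ω i, fun ω => Z ω j; μ'] = if i = j then σ2 else 0) :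
    HasLaw (fun ω => 1 / (v : ℝ) * (Z ω ⬝ᵥ (M *ᵥ Z ω)))
      ((chiSquare v).map fun z => σ2 / (v : ℝ) * z) μ' := by
  have := hZ.isProbabilityMeasure
  obtain ⟨u, hu, hsq⟩ := exists_orthonormal_dotProduct_mulVec hT hM hv
  have hi : ∀ i, MemLp (fun ω => Z ω i) 2 μ' := fun i => (hZ.eval i).memLp_two
  -- The rows of `T` are the orthonormal vectors `u_i`, so `T Z` has covariance `σ2 · I_v`.
  let T : (ι → ℝ) →L[ℝ] (Fin v → ℝ) :=
    LinearMap.toContinuousLinearMap (Matrix.mulVecLin (Matrix.of u))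
  have hTZ : ∀ z i, T z i = ∑ a, u i a * z a := fun z i => rfl
  have hlaw : HasLaw (fun ω => T (Z ω))
      ((Measure.pi fun _ : Fin v => gaussianReal 0 1).map fun z i => Real.sqrt σ2 * z i) μ' := by
    refine hasLaw_pi_gaussianReal (hZ.map_fun T) (fun i => ?_) fun i j => ?_
    · simp only [hTZ]
      rw [integral_finsetSum _ fun a _ => ((hi a).integrable one_le_two).const_mul _]
      simp [integral_const_mul, hmean]
    · simp only [hTZ]
      rw [covariance_fun_sum_fun_sum (fun a => (hi a).const_mul _) fun a => (hi a).const_mul _]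
      simp only [covariance_const_mul_left, covariance_const_mul_right, hcov, mul_ite, mul_zero,
        Finset.sum_ite_eq, Finset.mem_univ, if_true]
      have : ∑ a, u j a * (u i a * σ2) = (u i ⬝ᵥ u j) * σ2 := by
        simp only [dotProduct, Finset.sum_mul]
        exact Finset.sum_congr rfl fun a _ => by ring
      rw [this, hu]
      split_ifs <;> simp
  have hq : HasLaw (fun z : Fin v → ℝ => 1 / (v : ℝ) * ∑ i, z i ^ 2)
      ((chiSquare v).map fun z => σ2 / (v : ℝ) * z)
      ((Measure.pi fun _ : Fin v => gaussianReal 0 1).map fun z i => Real.sqrt σ2 * z i) := by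
    refine ⟨Measurable.aemeasurable (by fun_prop), ?_⟩
    rw [chiSquare, Measure.map_map (by fun_prop) (by fun_prop),
      Measure.map_map (by fun_prop) (by fun_prop)]
    congr 1
    ext z
    simp only [Function.comp_apply, mul_pow, Real.sq_sqrt hσ, ← Finset.mul_sum]
    ring
  refine (hq.fun_comp hlaw).congr (ae_of_all _ fun ω => ?_)
  simp only [hsq]
  rfl

end QuadraticForm

/-! ### Second moments of the scaled sums -/

section ScaledSum

variable {Ω : Type*} [MeasurableSpace Ω] {μ : Measure Ω} {n p q : ℕ}

lemma integral_sum_mul_sum {ι κ : Type*} [Fintype ι] [Fintype κ] {f : ι → Ω → ℝ} {g : κ → Ω → ℝ}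
    (hf : ∀ i, MemLp (f i) 2 μ) (hg : ∀ j, MemLp (g j) 2 μ) :
    ∫ ω, (∑ i, f i ω) * ∑ j, g j ω ∂μ = ∑ i, ∑ j, ∫ ω, f i ω * g j ω ∂μ := by
  have hfg : ∀ i j, Integrable (fun ω => f i ω * g j ω) μ := fun i j => (hf i).integrable_mul (hg j)
  simp only [Finset.sum_mul_sum]
  rw [integral_finsetSum _ fun i _ => integrable_finsetSum _ fun j _ => hfg i j]
  exact Finset.sum_congr rfl fun i _ => integral_finsetSum _ fun j _ => hfg i j

lemma memLp_scaledSum {k : ℝ → ℝ → ℝ} {X : Fin n → Fin p → Ω → ℝ} (hkX : KernelMoments μ k X)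
    (a : IdxPair n) : MemLp (fun ω => scaledSum μ k X ω a) 2 μ :=
  (memLp_finsetSum _ fun i _ => (hkX i a.1.1 a.1.2 a.2.ne).2).const_mul _

lemma integral_scaledSum_mul {k l : ℝ → ℝ → ℝ} {X : Fin n → Fin p → Ω → ℝ}
    {Y : Fin n → Fin q → Ω → ℝ} (hkX : KernelMoments μ k X) (hlY : KernelMoments μ l Y)
    (a b : IdxPair n) : ∫ ω, scaledSum μ k X ω a * scaledSum μ l Y ω b ∂μ =
      1 / Real.sqrt (p : ℝ) * (1 / Real.sqrt (q : ℝ)) * ∑ i : Fin p, ∑ j : Fin q,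
        ∫ ω, doubleCentered μ k (fun s => X s i) ω a.1.1 a.1.2
          * doubleCentered μ l (fun s => Y s j) ω b.1.1 b.1.2 ∂μ := by
  rw [← integral_sum_mul_sum (fun i => (hkX i a.1.1 a.1.2 a.2.ne).2)
    fun j => (hlY j b.1.1 b.1.2 b.2.ne).2, ← integral_const_mul]
  refine integral_congr_ae (ae_of_all _ fun ω => ?_)
  simp only [scaledSum]
  ring

/-- The summands are centered, so product moments are covariances. This identifies the second
moments with the normalized sums whose limits are assumed. -/
lemma integral_scaledSum_sq [IsProbabilityMeasure μ] {k : ℝ → ℝ → ℝ} {X : Fin n → Fin p → Ω → ℝ}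
    (hX : ∀ s i, Measurable (X s i)) (hkX : KernelMoments μ k X) (a : IdxPair n) :
    ∫ ω, scaledSum μ k X ω a ^ 2 ∂μ = 1 / (p : ℝ) * ∑ i : Fin p, ∑ j : Fin p,
      cov[fun ω => doubleCentered μ k (fun s => X s i) ω a.1.1 a.1.2,
        fun ω => doubleCentered μ k (fun s => X s j) ω a.1.1 a.1.2; μ] := by
  simp only [sq]
  rw [integral_scaledSum_mul hkX hkX, div_mul_div_comm, one_mul,
    Real.mul_self_sqrt (Nat.cast_nonneg p)]
  congr 1
  refine Finset.sum_congr rfl fun i _ => Finset.sum_congr rfl fun j _ => ?_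
  rw [covariance_eq_sub (hkX i a.1.1 a.1.2 a.2.ne).2 (hkX j a.1.1 a.1.2 a.2.ne).2,
    integral_doubleCentered (fun s => hX s i) (hkX i a.1.1 a.1.2 a.2.ne).1]
  simp

variable {P : Measure ((Fin p → ℝ) × (Fin q → ℝ))} {X : Fin n → Fin p → Ω → ℝ}
  {Y : Fin n → Fin q → Ω → ℝ} {k l : ℝ → ℝ → ℝ} {a b : IdxPair n}

namespace IsIIDSample

lemma measurable_obs (h : IsIIDSample μ P X Y) (s : Fin n) :
    Measurable fun ω => ((fun i => X s i ω : Fin p → ℝ), (fun j => Y s j ω : Fin q → ℝ)) :=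
  (measurable_pi_lambda _ fun i => h.measurable_X s i).prodMk
    (measurable_pi_lambda _ fun j => h.measurable_Y s j)

lemma integral_scaledSum_mul_xx [IsProbabilityMeasure μ] (h : IsIIDSample μ P X Y) (hk : IsKernel k)
    (hkX : KernelMoments μ k X) (hab : a ≠ b) :
    ∫ ω, scaledSum μ k X ω a * scaledSum μ k X ω b ∂μ = 0 := by
  rw [integral_scaledSum_mul hkX hkX, Finset.sum_eq_zero, mul_zero]
  refine fun i _ => Finset.sum_eq_zero fun j _ => ?_
  exact integral_doubleCentered_mul_of_ne (f := fun z => z.1 i) (g := fun z => z.1 j) h.indep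
    h.measurable_obs (by fun_prop) (by fun_prop) hk hk hab (hkX i _ _ a.2.ne).1
    (hkX i _ _ a.2.ne).2 (hkX j _ _ b.2.ne).2

lemma integral_scaledSum_mul_yy [IsProbabilityMeasure μ] (h : IsIIDSample μ P X Y) (hl : IsKernel l)
    (hlY : KernelMoments μ l Y) (hab : a ≠ b) :
    ∫ ω, scaledSum μ l Y ω a * scaledSum μ l Y ω b ∂μ = 0 := by
  rw [integral_scaledSum_mul hlY hlY, Finset.sum_eq_zero, mul_zero]
  refine fun i _ => Finset.sum_eq_zero fun j _ => ?_
  exact integral_doubleCentered_mul_of_ne (f := fun z => z.2 i) (g := fun z => z.2 j) h.indep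
    h.measurable_obs (by fun_prop) (by fun_prop) hl hl hab (hlY i _ _ a.2.ne).1
    (hlY i _ _ a.2.ne).2 (hlY j _ _ b.2.ne).2

/-- Within one observation the `x` and `y` coordinates may be dependent; independence across whole
observations `(X_s, Y_s)` is enough, as the two kernels are coordinate functions of the same sample.
-/
lemma integral_scaledSum_mul_xy [IsProbabilityMeasure μ] (h : IsIIDSample μ P X Y)
    (hk : IsKernel k) (hl : IsKernel l)
    (hkX : KernelMoments μ k X) (hlY : KernelMoments μ l Y) (hab : a ≠ b) :
    ∫ ω, scaledSum μ k X ω a * scaledSum μ l Y ω b ∂μ = 0 := by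
  rw [integral_scaledSum_mul hkX hlY, Finset.sum_eq_zero, mul_zero]
  refine fun i _ => Finset.sum_eq_zero fun j _ => ?_
  exact integral_doubleCentered_mul_of_ne (f := fun z => z.1 i) (g := fun z => z.2 j) h.indep
    h.measurable_obs (by fun_prop) (by fun_prop) hk hl hab (hkX i _ _ a.2.ne).1
    (hkX i _ _ a.2.ne).2 (hlY j _ _ b.2.ne).2

end IsIIDSample

end ScaledSum

/-! ### The joint law of `(𝐜, 𝐝)` -/

section JointLimit

variable {n : ℕ} {Ω : ℕ × ℕ → Type*} [∀ r, MeasurableSpace (Ω r)]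
  {μ : (r : ℕ × ℕ) → Measure (Ω r)} [∀ r, IsProbabilityMeasure (μ r)]
  {P : (r : ℕ × ℕ) → Measure ((Fin r.1 → ℝ) × (Fin r.2 → ℝ))}
  {X : (r : ℕ × ℕ) → Fin n → Fin r.1 → Ω r → ℝ}
  {Y : (r : ℕ × ℕ) → Fin n → Fin r.2 → Ω r → ℝ} {k l : ℝ → ℝ → ℝ}
  {Ω' : Type*} [MeasurableSpace Ω'] {μ' : Measure Ω'} [IsProbabilityMeasure μ']
  {c d : Ω' → IdxPair n → ℝ} {σx2 σy2 σxy2 : ℝ}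

namespace JointGaussianCLT

lemma hasGaussianLaw_prod (h : JointGaussianCLT μ k l X Y μ' c d σx2 σy2 σxy2) :
    HasGaussianLaw (fun ω => (c ω, d ω)) μ' := ⟨h.gaussian⟩

/-- Merging `c` and `d` into one family over a sum type lets the moment argument treat all four
covariance blocks at once. -/
lemma hasGaussianLaw_sumElim (h : JointGaussianCLT μ k l X Y μ' c d σx2 σy2 σxy2) :
    HasGaussianLaw (fun ω => Sum.elim (c ω) (d ω)) μ' := by
  let T : ((IdxPair n → ℝ) × (IdxPair n → ℝ)) →L[ℝ] (IdxPair n ⊕ IdxPair n → ℝ) :=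
    LinearMap.toContinuousLinearMap (LinearEquiv.sumArrowLequivProdArrow _ _ ℝ ℝ).symm.toLinearMap
  exact h.hasGaussianLaw_prod.map_fun T

/-- The limit is centered, with the covariance matrix of the theorem. -/
lemma integral_eq_zero_and_covariance (h : JointGaussianCLT μ k l X Y μ' c d σx2 σy2 σxy2)
    (hXY : ∀ r, IsIIDSample (μ r) (P r) (X r) (Y r)) (hk : IsKernel k) (hl : IsKernel l)
    (hkX : ∀ r, KernelMoments (μ r) k (X r)) (hlY : ∀ r, KernelMoments (μ r) l (Y r)) :
    (∀ i, ∫ ω, Sum.elim (c ω) (d ω) i ∂μ' = 0) ∧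
      ∀ i j, cov[fun ω => Sum.elim (c ω) (d ω) i, fun ω => Sum.elim (c ω) (d ω) j; μ'] =
        blockCov n σx2 σy2 σxy2 i j := by
  have hZ : ∀ i, MemLp (fun ω => Sum.elim (c ω) (d ω) i) 2 μ' := fun i =>
    (h.hasGaussianLaw_sumElim.eval i).memLp_two
  have hcont : Continuous fun z : (IdxPair n → ℝ) × (IdxPair n → ℝ) => Sum.elim z.1 z.2 := by
    refine continuous_pi fun i => ?_
    rcases i with a | a
    · exact (continuous_apply a).comp continuous_fst
    · exact (continuous_apply a).comp continuous_snd
  obtain ⟨hmean, hcov⟩ := centered_and_uncorrelated_of_tendstoInDistribution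
    (S := fun r ω => Sum.elim (scaledSum (μ r) k (X r) ω) (scaledSum (μ r) l (Y r) ω))
    (Z := fun ω => Sum.elim (c ω) (d ω)) (h.tendsto.continuous_comp hcont)
    (fun r i => by
      rcases i with a | a
      · exact memLp_scaledSum (hkX r) a
      · exact memLp_scaledSum (hlY r) a)
    hZ
    (fun i => by
      rcases i with a | a
      · rw [show Var[fun ω => Sum.elim (c ω) (d ω) (Sum.inl a); μ'] = σx2 from h.var_c a]
        exact (h.tendsto_x a).congr fun r =>
          (integral_scaledSum_sq (hXY r).measurable_X (hkX r) a).symm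
      · rw [show Var[fun ω => Sum.elim (c ω) (d ω) (Sum.inr a); μ'] = σy2 from h.var_d a]
        exact (h.tendsto_y a).congr fun r =>
          (integral_scaledSum_sq (hXY r).measurable_Y (hlY r) a).symm)
  refine ⟨hmean, fun i j => ?_⟩
  -- In each block, the entries at equal pairs are assumed, and those at distinct pairs vanish by
  -- orthogonality before the limit.
  rcases i with a | a <;> rcases j with b | b <;>
    by_cases hab : a = b <;> simp only [blockCov, Matrix.fromBlocks_apply₁₁,
      Matrix.fromBlocks_apply₁₂, Matrix.fromBlocks_apply₂₁, Matrix.fromBlocks_apply₂₂,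
      Matrix.smul_apply, smul_eq_mul, Matrix.one_apply, hab, if_true, if_false, mul_one, mul_zero]
  · exact (covariance_self (hZ (Sum.inl b)).aemeasurable).trans (h.var_c b)
  · exact hcov (Sum.inl a) (Sum.inl b) fun r => (hXY r).integral_scaledSum_mul_xx hk (hkX r) hab
  · exact h.cov_cd b
  · exact hcov (Sum.inl a) (Sum.inr b) fun r =>
      (hXY r).integral_scaledSum_mul_xy hk hl (hkX r) (hlY r) hab
  · rw [covariance_comm]
    exact h.cov_cd b
  · rw [covariance_comm]
    exact hcov (Sum.inl b) (Sum.inr a) fun r =>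
      (hXY r).integral_scaledSum_mul_xy hk hl (hkX r) (hlY r) (Ne.symm hab)
  · exact (covariance_self (hZ (Sum.inr b)).aemeasurable).trans (h.var_d b)
  · exact hcov (Sum.inr a) (Sum.inr b) fun r => (hXY r).integral_scaledSum_mul_yy hl (hlY r) hab

end JointGaussianCLT

end JointLimit

/-! ### The limit theorem -/

theorem theorem3 (n : ℕ) (hn : 4 ≤ n)
    {Ω : ℕ × ℕ → Type*} [∀ r, MeasurableSpace (Ω r)]
    (μ : (r : ℕ × ℕ) → Measure (Ω r)) [∀ r, IsProbabilityMeasure (μ r)]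
    (P : (r : ℕ × ℕ) → Measure ((Fin r.1 → ℝ) × (Fin r.2 → ℝ)))
    (X : (r : ℕ × ℕ) → Fin n → Fin r.1 → Ω r → ℝ)
    (Y : (r : ℕ × ℕ) → Fin n → Fin r.2 → Ω r → ℝ)
    (hXY : ∀ r, IsIIDSample (μ r) (P r) (X r) (Y r))
    (k l : ℝ → ℝ → ℝ) (hk : IsKernel k) (hl : IsKernel l)
    (hkX : ∀ r, KernelMoments (μ r) k (X r)) (hlY : ∀ r, KernelMoments (μ r) l (Y r))
    (hD1 : UniformMomentBounds P)
    {Ω' : Type*} [MeasurableSpace Ω'] (μ' : Measure Ω') [IsProbabilityMeasure μ']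
    (c d : Ω' → IdxPair n → ℝ) (σx2 σy2 σxy2 : ℝ)
    (hD3 : JointGaussianCLT μ k l X Y μ' c d σx2 σy2 σxy2)
    (v : ℕ) (hv : v = n * (n - 3) / 2) :
    -- `𝐌` is a projection matrix of rank `v`
    ((projMatrix n)ᵀ = projMatrix n ∧ projMatrix n * projMatrix n = projMatrix n ∧
      (projMatrix n).rank = v) ∧
    -- the law of `(𝐜, 𝐝)`
    ((blockCov n σx2 σy2 σxy2).PosSemidef ∧
      HasLaw (fun ω => WithLp.toLp 2 (Sum.elim (c ω) (d ω)))
        (multivariateGaussian 0 (blockCov n σx2 σy2 σxy2)) μ') ∧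
    -- the limit of `uCov_n²(𝐗, 𝐘)`
    TendstoInDistribution (fun r => uCov (μ r) k l (X r) (Y r)) atTop
      (fun ω => 1 / (v : ℝ) * (c ω ⬝ᵥ (projMatrix n *ᵥ d ω))) μ μ' ∧
    -- the limit of `uCov_n²(𝐗, 𝐗)`
    (TendstoInDistribution (fun r => uCov (μ r) k k (X r) (X r)) atTop
        (fun ω => 1 / (v : ℝ) * (c ω ⬝ᵥ (projMatrix n *ᵥ c ω))) μ μ' ∧
      HasLaw (fun ω => 1 / (v : ℝ) * (c ω ⬝ᵥ (projMatrix n *ᵥ c ω)))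
        ((chiSquare v).map fun z => σx2 / (v : ℝ) * z) μ') ∧
    -- the limit of `uCov_n²(𝐘, 𝐘)`
    (TendstoInDistribution (fun r => uCov (μ r) l l (Y r) (Y r)) atTop
        (fun ω => 1 / (v : ℝ) * (d ω ⬝ᵥ (projMatrix n *ᵥ d ω))) μ μ' ∧
      HasLaw (fun ω => 1 / (v : ℝ) * (d ω ⬝ᵥ (projMatrix n *ᵥ d ω)))
        ((chiSquare v).map fun z => σy2 / (v : ℝ) * z) μ') := by
  have hM2 := projMatrix_mul_self (n := n) (by omega)
  have hMT := projMatrix_transpose n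
  have hrank := projMatrix_rank hn hv
  obtain ⟨hmean, hcov⟩ := hD3.integral_eq_zero_and_covariance hXY hk hl hkX hlY
  have hG := hD3.hasGaussianLaw_sumElim
  -- Any pair will do: it exhibits `σx2` and `σy2` as variances, hence nonnegative.
  let a₀ : IdxPair n := ⟨(⟨0, by omega⟩, ⟨1, by omega⟩), by simp [Fin.lt_def]⟩
  have hσx : 0 ≤ σx2 := hD3.var_c a₀ ▸ variance_nonneg _ _
  have hσy : 0 ≤ σy2 := hD3.var_d a₀ ▸ variance_nonneg _ _
  refine ⟨⟨hMT, hM2, hrank⟩, ⟨posSemidef_of_covariance (fun i => (hG.eval i).memLp_two) hcov,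
    hasLaw_multivariateGaussian hG hmean hcov⟩, ?_, ⟨?_, ?_⟩, ?_, ?_⟩
  · rw [show (fun r => uCov (μ r) k l (X r) (Y r)) = _ from
      funext fun r => funext fun ω => uCov_eq (μ r) hn hv hk hl (X r) (Y r) ω]
    exact hD3.tendsto.continuous_comp (g := fun z : (IdxPair n → ℝ) × (IdxPair n → ℝ) =>
      1 / (v : ℝ) * (z.1 ⬝ᵥ (projMatrix n *ᵥ z.2))) (by fun_prop)
  · rw [show (fun r => uCov (μ r) k k (X r) (X r)) = _ from
      funext fun r => funext fun ω => uCov_eq (μ r) hn hv hk hk (X r) (X r) ω]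
    exact hD3.tendsto.continuous_comp (g := fun z : (IdxPair n → ℝ) × (IdxPair n → ℝ) =>
      1 / (v : ℝ) * (z.1 ⬝ᵥ (projMatrix n *ᵥ z.1))) (by fun_prop)
  · refine hasLaw_chiSquare_quadraticForm hMT hM2 hrank hD3.hasGaussianLaw_prod.fst hσx
      (fun a => hmean (Sum.inl a)) fun a b => (hcov (Sum.inl a) (Sum.inl b)).trans ?_
    simp [blockCov, Matrix.one_apply]
  · rw [show (fun r => uCov (μ r) l l (Y r) (Y r)) = _ from
      funext fun r => funext fun ω => uCov_eq (μ r) hn hv hl hl (Y r) (Y r) ω]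
    exact hD3.tendsto.continuous_comp (g := fun z : (IdxPair n → ℝ) × (IdxPair n → ℝ) =>
      1 / (v : ℝ) * (z.2 ⬝ᵥ (projMatrix n *ᵥ z.2))) (by fun_prop)
  · refine hasLaw_chiSquare_quadraticForm hMT hM2 hrank hD3.hasGaussianLaw_prod.snd hσy
      (fun a => hmean (Sum.inr a)) fun a b => (hcov (Sum.inr a) (Sum.inr b)).trans ?_
    simp [blockCov, Matrix.one_apply]
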